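/- Let $X\subset\mathbb{R}^2$ be a closed semialgebraic set whose germ at the origin has dimension $1$, i.e. $\dim_0 X=1$ (in particular $0\in X$). Here $\dim_0 X=\min_U \dim(X\cap U)$ over all open neighbourhoods $U$ of $0$, where $\dim Y$ is the largest dimension of a nonempty semialgebraic $C^1$ submanifold contained in $Y$. For $Y\subset\mathbb{R}^2$ and $x,y\in Y$ let $d_Y(x,y)$ be the infimum of the lengths of rectifiable paths in $Y$ joining $x$ to $y$ ($+\infty$ if there are none); $Y$ is called normally embedded if there is $C>0$ with $d_Y(x,y)\le C\|x-y\|$ for all $x,y\in Y$, and the germ $(X,0)$ is called normally embedded if $X\cap U$ is normally embedded for some open neighbourhood $U$ of $0$. Let $$M_X=\{x\in\mathbb{R}^2\setminus X \;:\; \text{there is more than one } y\in X \text{ with } \|x-y\|=\operatorname{dist}(x,X)\}$$ be the medial axis of $X$. If the germ $(X,0)$ is not normally embedded, then $0\in\overline{M_X}\cap X$. -/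

import Mathlib

open Set
open scoped ENNReal NNReal

namespace PlaneGerm

/-- The Euclidean space `ℝⁿ`, with its Euclidean norm. -/
abbrev Euc (n : ℕ) : Type := EuclideanSpace ℝ (Fin n)

/-- The set where all polynomials of `Z` vanish and all polynomials of `P` are positive. -/
def basicSet {n : ℕ} (Z P : Finset (MvPolynomial (Fin n) ℝ)) : Set (Euc n) :=
  {x | (∀ f ∈ Z, MvPolynomial.eval (fun i => x i) f = 0) ∧
       (∀ g ∈ P, 0 < MvPolynomial.eval (fun i => x i) g)}

/-- A subset of `ℝⁿ` is semialgebraic if it is a finite union of sets, each given by finitely many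
polynomial equations and strict polynomial inequalities. -/
def IsSemialgebraic {n : ℕ} (S : Set (Euc n)) : Prop :=
  ∃ F : Finset (Finset (MvPolynomial (Fin n) ℝ) × Finset (MvPolynomial (Fin n) ℝ)),
    S = ⋃ p ∈ F, basicSet p.1 p.2

/-- `Γ` is an (embedded) `k`-dimensional submanifold of `ℝⁿ` of class `C¹`: near each of its points
a `C¹` diffeomorphism between open subsets of `ℝⁿ` straightens `Γ` to the coordinate subspace
of the first `k` coordinates. -/
def IsC1Submanifold {n : ℕ} (k : ℕ) (Γ : Set (Euc n)) : Prop :=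
  k ≤ n ∧ ∀ p ∈ Γ, ∃ φ : OpenPartialHomeomorph (Euc n) (Euc n),
    p ∈ φ.source ∧ ContDiffOn ℝ 1 φ φ.source ∧ ContDiffOn ℝ 1 φ.symm φ.target ∧
      ∀ x ∈ φ.source, (x ∈ Γ ↔ ∀ i : Fin n, k ≤ (i : ℕ) → φ x i = 0)

/-- The dimension of `X`: the largest dimension of a nonempty semialgebraic `C¹` submanifold
contained in `X` (and `⊥` if there is none, for instance if `X = ∅`). -/
noncomputable def dim {n : ℕ} (X : Set (Euc n)) : WithBot ℕ∞ :=
  ⨆ k ∈ {k : ℕ | ∃ Γ : Set (Euc n), Γ ⊆ X ∧ Γ.Nonempty ∧ IsSemialgebraic Γ ∧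
    IsC1Submanifold k Γ}, ((k : ℕ∞) : WithBot ℕ∞)

/-- The dimension of `X` at `a`, i.e. of the germ `(X, a)`: the least dimension of `X ∩ U` over
the open neighbourhoods `U` of `a`. -/
noncomputable def dimAt {n : ℕ} (X : Set (Euc n)) (a : Euc n) : WithBot ℕ∞ :=
  ⨅ U ∈ {U : Set (Euc n) | IsOpen U ∧ a ∈ U}, dim (X ∩ U)

/-- The rectifiable paths `γ : [0, 1] → X` from `x` to `y` (only the values of `γ` on `[0, 1]`
matter). -/
def rectifiablePaths {n : ℕ} (X : Set (Euc n)) (x y : Euc n) : Set (ℝ → Euc n) :=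
  {γ | ContinuousOn γ (Icc 0 1) ∧ MapsTo γ (Icc 0 1) X ∧ γ 0 = x ∧ γ 1 = y ∧
    eVariationOn γ (Icc 0 1) ≠ ∞}

/-- The inner (length) distance on `X`: the infimum of the lengths of the rectifiable paths in `X`
from `x` to `y`, equal to `∞` if there is no such path. -/
noncomputable def innerEDist {n : ℕ} (X : Set (Euc n)) (x y : Euc n) : ℝ≥0∞ :=
  ⨅ γ ∈ rectifiablePaths X x y, eVariationOn γ (Icc 0 1)

/-- `X` is Lipschitz normally embedded: its inner distance is bounded by a constant times the
Euclidean distance. -/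
def IsNormallyEmbedded {n : ℕ} (X : Set (Euc n)) : Prop :=
  ∃ C : ℝ≥0, 0 < C ∧ ∀ x ∈ X, ∀ y ∈ X, innerEDist X x y ≤ C * edist x y

/-- The germ `(X, a)` is normally embedded: some neighbourhood of `a` in `X` is. -/
def IsNormallyEmbeddedAt {n : ℕ} (X : Set (Euc n)) (a : Euc n) : Prop :=
  ∃ U : Set (Euc n), IsOpen U ∧ a ∈ U ∧ IsNormallyEmbedded (X ∩ U)

/-- The set `m(x)` of the points of `X` closest to `x`. -/
def closestPoints {n : ℕ} (X : Set (Euc n)) (x : Euc n) : Set (Euc n) :=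
  {y | y ∈ X ∧ ‖y - x‖ = Metric.infDist x X}

/-- The medial axis of `X`: the points outside `X` with more than one closest point in `X`. -/
def medialAxis {n : ℕ} (X : Set (Euc n)) : Set (Euc n) :=
  {x | x ∉ X ∧ 1 < (closestPoints X x).encard}

end PlaneGerm

/-! By contraposition: off the closure of the medial axis, nearest points are unique in a ball
around `0`, so `X` has positive reach there. A ball missing `X` and touching it at `p` can then be
inflated to a fixed radius `S` while staying tangent at `p` (`exists_infDist_ge_of_unique`,
`inner_sub_le_of_unique`). These tangent balls make the nearest-point projection 2-Lipschitz near
`0` (`norm_proj_sub_le`). Projecting the segment from `x` to `y` gives a path in `X` of length at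
most `2‖x - y‖`, and `norm_proj_lt` keeps it in the chosen ball. -/

open Set Filter Topology

namespace PlaneGerm

/-! ### Tangent balls and the nearest-point projection -/

section Reach

variable {E : Type*} [NormedAddCommGroup E] [InnerProductSpace ℝ E]

local notation "⟪" x ", " y "⟫" => inner ℝ x y

/-- Away from a unique nearest point, the distance to a closed set grows at unit rate. -/
theorem eventually_le_infDist_add_smul [ProperSpace E] {X : Set E} (hX : IsClosed X)
    {c q u : E} {s κ : ℝ}
    (hs : 0 < s) (hq : q ∈ X) (hu : ‖u‖ = 1) (hcq : c - q = s • u)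
    (hmin : ∀ y ∈ X, s ≤ ‖c - y‖) (huniq : ∀ y ∈ X, ‖c - y‖ = s → y = q)
    (hκ0 : 0 ≤ κ) (hκ1 : κ < 1) :
    ∀ᶠ ε in 𝓝[>] (0 : ℝ), s + κ * ε ≤ Metric.infDist (c + ε • u) X := by
  -- The threshold lies strictly between `κ * s` and `s`, the value at `q`. Points below it form a
  -- closed set without `q`, hence stay a definite amount farther from `c`; those above it recede
  -- faster than `κ`.
  obtain ⟨m, hsm, hm⟩ : ∃ m, s < m ∧ ∀ y ∈ X, ⟪u, c - y⟫ ≤ (1 + κ) / 2 * s → m ≤ ‖c - y‖ := by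
    set Y : Set E := X ∩ {y | ⟪u, c - y⟫ ≤ (1 + κ) / 2 * s} with hY
    have hYc : IsClosed Y := hX.inter (isClosed_le (by fun_prop) continuous_const)
    rcases Y.eq_empty_or_nonempty with he | hne
    · refine ⟨s + 1, by linarith, fun y hy h => ?_⟩
      have : y ∈ Y := ⟨hy, h⟩
      simp [he] at this
    · obtain ⟨y₀, hy₀, hd⟩ := hYc.exists_infDist_eq_dist hne c
      refine ⟨Metric.infDist c Y, ?_, fun y hy h => ?_⟩
      · rw [hd, dist_eq_norm]
        refine lt_of_le_of_ne (hmin _ hy₀.1) fun h => ?_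
        have h2 := hy₀.2
        rw [huniq _ hy₀.1 h.symm] at h2
        simp only [mem_ofPred_eq, hcq, real_inner_smul_right, real_inner_self_eq_norm_sq, hu] at h2
        nlinarith
      · rw [← dist_eq_norm]
        exact Metric.infDist_le_dist_of_mem (show y ∈ Y from ⟨hy, h⟩)
  have h1 : ∀ᶠ ε in 𝓝[>] (0 : ℝ), ε < (m - s) / 2 :=
    mem_nhdsWithin_of_mem_nhds (Iio_mem_nhds (by linarith))
  have h2 : ∀ᶠ ε in 𝓝[>] (0 : ℝ), ε < (1 - κ) * s :=
    mem_nhdsWithin_of_mem_nhds (Iio_mem_nhds (by nlinarith))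
  filter_upwards [h1, h2, self_mem_nhdsWithin] with ε h1 h2 (h0 : 0 < ε)
  refine (Metric.le_infDist ⟨q, hq⟩).2 fun {y} hy => ?_
  rw [dist_eq_norm]
  by_cases h : ⟪u, c - y⟫ ≤ (1 + κ) / 2 * s
  · have h3 : ‖c - y‖ ≤ ‖c + ε • u - y‖ + ε := by
      calc ‖c - y‖ = ‖(c + ε • u - y) - ε • u‖ := by congr 1; abel
        _ ≤ ‖c + ε • u - y‖ + ‖ε • u‖ := norm_sub_le _ _
        _ = _ := by rw [norm_smul, hu, Real.norm_of_nonneg h0.le, mul_one]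
    have := hm y hy h
    nlinarith
  · have h3 : ‖c + ε • u - y‖ ^ 2 = ‖c - y‖ ^ 2 + 2 * (ε * ⟪u, c - y⟫) + ε ^ 2 := by
      rw [show c + ε • u - y = (c - y) + ε • u by abel, norm_add_sq_real, real_inner_smul_right,
        real_inner_comm, norm_smul, hu, Real.norm_of_nonneg h0.le, mul_one]
    have h4 := hmin y hy
    refine abs_le_of_sq_le_sq' ?_ (norm_nonneg _) |>.2
    rw [h3]
    have h5 : s ^ 2 ≤ ‖c - y‖ ^ 2 := by gcongr
    have h6 : ε * ((1 + κ) / 2 * s) ≤ ε * ⟪u, c - y⟫ := by gcongr; exact (not_le.1 h).le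
    have h7 : 0 ≤ ε * ((1 - κ) * s) := by have := sub_pos.2 hκ1; positivity
    nlinarith [mul_nonneg (mul_nonneg h0.le h0.le) hκ0, mul_nonneg h0.le h0.le]

/-- Moving a point at distance `L` from `z` in a unit direction not pointing straight away from
`z` increases the distance at a rate smaller than one. -/
theorem eventually_norm_add_smul_le {w u : E} {L : ℝ} (hL : 0 < L) (hw : ‖w‖ ≤ L) (hu : ‖u‖ = 1)
    (hne : w ≠ L • u) :
    ∃ κ, 0 ≤ κ ∧ κ < 1 ∧ ∀ᶠ ε in 𝓝[>] (0 : ℝ), ‖w + ε • u‖ ≤ L + κ * ε := by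
  have hlt : ⟪w, u⟫ < L := by
    refine lt_of_le_of_ne ((real_inner_le_norm w u).trans (by rw [hu, mul_one]; exact hw))
      fun h => hne ?_
    have h1 : ‖w - L • u‖ ^ 2 = ‖w‖ ^ 2 - L ^ 2 := by
      rw [norm_sub_sq_real, real_inner_smul_right, h, norm_smul, hu, Real.norm_of_nonneg hL.le]
      ring
    have h2 : ‖w‖ ^ 2 ≤ L ^ 2 := by gcongr
    have h3 : ‖w - L • u‖ = 0 := by
      have := sq_nonneg ‖w - L • u‖
      exact pow_eq_zero_iff two_ne_zero |>.1 (by linarith)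
    exact sub_eq_zero.1 (norm_eq_zero.1 h3)
  obtain ⟨κ, hκ, hκ1⟩ := exists_between (show max 0 (⟪w, u⟫ / L) < 1 from
    max_lt one_pos ((div_lt_one hL).2 hlt))
  have hκ0 := (le_max_left _ _).trans_lt hκ
  have hκ2 : ⟪w, u⟫ < κ * L := (div_lt_iff₀ hL).1 ((le_max_right _ _).trans_lt hκ)
  refine ⟨κ, hκ0.le, hκ1, ?_⟩
  have h1 : ∀ᶠ ε in 𝓝[>] (0 : ℝ), ε < κ * L - ⟪w, u⟫ :=
    mem_nhdsWithin_of_mem_nhds (Iio_mem_nhds (by linarith))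
  filter_upwards [h1, self_mem_nhdsWithin] with ε h1 (h0 : 0 < ε)
  refine abs_le_of_sq_le_sq' ?_ (by positivity) |>.2
  rw [norm_add_sq_real, real_inner_smul_right, norm_smul, hu, Real.norm_of_nonneg h0.le]
  have h2 : ‖w‖ ^ 2 ≤ L ^ 2 := by gcongr
  nlinarith [mul_nonneg (mul_nonneg hκ0.le h0.le) (mul_nonneg hκ0.le h0.le),
    mul_lt_mul_of_pos_left h1 h0, mul_pos h0 h0]

/-- If nearest points are unique around `z`, the open ball around `z` missing `X` is, up to `η`,
contained in an open ball of prescribed radius `S` missing `X`. -/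
theorem exists_infDist_ge_of_unique [ProperSpace E] {X : Set E} (hX : IsClosed X)
    (hne : X.Nonempty) {z : E} {S η : ℝ} (hz : 0 < Metric.infDist z X) (hzS : Metric.infDist z X ≤ S) (hη : 0 < η)
    (hηd : η < Metric.infDist z X)
    (huniq : ∀ c, ‖c - z‖ ≤ S - Metric.infDist z X + η → c ∉ X →
      ∀ p ∈ X, ∀ q ∈ X, ‖c - p‖ = Metric.infDist c X → ‖c - q‖ = Metric.infDist c X → p = q) :
    ∃ c, ‖c - z‖ ≤ S - Metric.infDist z X + η ∧ S ≤ Metric.infDist c X := by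
  set d := Metric.infDist z X with hd
  -- Pairs of a centre and a radius of a ball missing `X`; the largest radius should be `S`.
  set A : Set (E × ℝ) :=
    {a | ‖a.1 - z‖ ≤ a.2 - d + η ∧ a.2 ≤ Metric.infDist a.1 X ∧ a.2 ≤ S} with hA
  have hδ : Continuous fun a : E × ℝ => Metric.infDist a.1 X :=
    (Metric.continuous_infDist_pt X).comp continuous_fst
  have hAc : IsClosed A :=
    (isClosed_le (f := fun a : E × ℝ => ‖a.1 - z‖) (g := fun a => a.2 - d + η)
      (by fun_prop) (by fun_prop)).inter
      ((isClosed_le continuous_snd hδ).inter (isClosed_le continuous_snd continuous_const))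
  have hAsub : A ⊆ Metric.closedBall z (S - d + η) ×ˢ Icc (d - η) S := by
    rintro ⟨c, s⟩ ⟨h1, h2, h3⟩
    simp only at h1 h2 h3
    have := norm_nonneg (c - z)
    refine ⟨?_, ?_, h3⟩
    · rw [mem_closedBall_iff_norm]; simp only; linarith
    · simp only; linarith
  have hAK : IsCompact A :=
    ((isCompact_closedBall _ _).prod isCompact_Icc).of_isClosed_subset hAc hAsub
  have hzA : (z, d) ∈ A := by
    refine ⟨?_, le_rfl, hzS⟩
    simp [hη.le]
  obtain ⟨⟨c, s⟩, ⟨h1, h2, h3⟩, hmax⟩ :=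
    hAK.exists_isMaxOn ⟨_, hzA⟩ (continuous_snd.continuousOn (s := A))
  simp only at h1 h2 h3
  have hmax' : ∀ c' s', (c', s') ∈ A → s' ≤ s := fun c' s' h => hmax h
  have hds : d ≤ s := hmax' _ _ hzA
  rcases h3.eq_or_lt with rfl | hlt
  · exact ⟨c, h1, h2⟩
  exfalso
  have hs : 0 < s := hz.trans_le hds
  obtain ⟨q, hq, hcq⟩ := hX.exists_infDist_eq_dist hne c
  rw [dist_eq_norm] at hcq
  have hcX : c ∉ X := fun h => by
    rw [Metric.infDist_zero_of_mem h] at h2; linarith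
  set s₁ := Metric.infDist c X with hs₁
  have hs₁0 : 0 < s₁ := hs.trans_le h2
  set u := s₁⁻¹ • (c - q) with hu_def
  have hu : ‖u‖ = 1 := by
    rw [hu_def, norm_smul, norm_inv, Real.norm_of_nonneg hs₁0.le, ← hcq, inv_mul_cancel₀ hs₁0.ne']
  have hcu : c - q = s₁ • u := by rw [hu_def, smul_inv_smul₀ hs₁0.ne']
  have hmin : ∀ y ∈ X, s₁ ≤ ‖c - y‖ := fun y hy => by
    rw [← dist_eq_norm]; exact Metric.infDist_le_dist_of_mem hy
  have hun : ∀ y ∈ X, ‖c - y‖ = s₁ → y = q := fun y hy h =>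
    huniq c (by linarith) hcX y hy q hq h hcq.symm
  have hL : 0 < s - d + η := by linarith
  have hs₁s : s₁ = s := by
    refine le_antisymm ?_ h2
    have := hmax' c (min s₁ S) ⟨?_, min_le_left _ _, min_le_right _ _⟩
    · rcases min_le_iff.1 this with h | h
      · exact h
      · linarith
    · have := le_min h2 h3
      simp only
      linarith
  -- The slack `η` is used here: equality would put a point of `X` at distance `d - η` from `z`.
  -- Hence moving `c` along `u` increases the radius faster than `‖c - z‖`, against maximality.
  have hnot : c - z ≠ (s - d + η) • u := fun h => by
    have h4 : z - q = (d - η) • u := by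
      rw [show d - η = s₁ - (s - d + η) by rw [hs₁s]; ring, sub_smul, ← hcu, ← h]; abel
    have h5 : d ≤ ‖z - q‖ := by rw [← dist_eq_norm]; exact Metric.infDist_le_dist_of_mem hq
    rw [h4, norm_smul, hu, mul_one, Real.norm_of_nonneg (by linarith)] at h5
    linarith
  obtain ⟨κ, hκ0, hκ1, hκ⟩ := eventually_norm_add_smul_le hL h1 hu hnot
  obtain ⟨κ', hκκ', hκ'1⟩ := exists_between hκ1
  have hgrow := eventually_le_infDist_add_smul hX hs₁0 hq hu hcu hmin hun
    (hκ0.trans hκκ'.le) hκ'1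
  have hsmall : ∀ᶠ ε in 𝓝[>] (0 : ℝ), ε < S - s :=
    mem_nhdsWithin_of_mem_nhds (Iio_mem_nhds (by linarith))
  obtain ⟨ε, hε, hg, hεs, hε0 : 0 < ε⟩ :=
    (hκ.and (hgrow.and (hsmall.and self_mem_nhdsWithin))).exists
  have h6 : κ * ε ≤ κ' * ε := by gcongr
  have h7 : κ' * ε ≤ ε := by nlinarith
  have h8 := hmax' (c + ε • u) (s + κ' * ε) ⟨?_, ?_, ?_⟩
  · have := mul_pos (hκ0.trans_lt hκκ') hε0
    linarith
  · rw [show c - z + ε • u = c + ε • u - z by abel] at hε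
    simp only
    linarith
  · rw [hs₁s] at hg; exact hg
  · simp only
    linarith

/-- If nearest points are unique around `z`, then the normal segment at the nearest point `p` of
`z` can be prolonged: `X` lies outside a ball of radius `S` tangent at `p`. -/
theorem inner_sub_le_of_unique [ProperSpace E] {X : Set E} (hX : IsClosed X) {z p x : E} {S T : ℝ}
    (hp : p ∈ X) (hzp : ‖z - p‖ = Metric.infDist z X) (hx : x ∈ X)
    (hzS : Metric.infDist z X ≤ S) (hST : S < T)
    (huniq : ∀ c, ‖c - z‖ < T → c ∉ X →
      ∀ p ∈ X, ∀ q ∈ X, ‖c - p‖ = Metric.infDist c X → ‖c - q‖ = Metric.infDist c X → p = q) :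
    2 * S * ⟪x - p, z - p⟫ ≤ Metric.infDist z X * ‖x - p‖ ^ 2 := by
  set d := Metric.infDist z X with hd
  rcases (Metric.infDist_nonneg : 0 ≤ Metric.infDist z X).eq_or_lt with h0 | hd0
  · rw [← hd] at h0
    have : z - p = 0 := norm_eq_zero.1 (by rw [hzp, ← h0])
    rw [this, inner_zero_right, ← h0]
    simp
  have hex : ∀ η, 0 < η → η < d → ∃ c, ‖c - z‖ ≤ S - d + η ∧ S ≤ Metric.infDist c X :=
    fun η hη hηd => exists_infDist_ge_of_unique hX ⟨p, hp⟩ hd0 hzS hη hηd fun c hc =>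
      huniq c (by rw [← hd] at hc; linarith)
  set Y : Set E := {c | S ≤ Metric.infDist c X} with hY
  have hYc : IsClosed Y := isClosed_le continuous_const (Metric.continuous_infDist_pt X)
  obtain ⟨c₁, -, hc₁⟩ := hex (d / 2) (by linarith) (by linarith)
  obtain ⟨c, hcY : S ≤ Metric.infDist c X, hc⟩ := hYc.exists_infDist_eq_dist ⟨c₁, hc₁⟩ z
  -- Let `η` tend to `0`.
  have hcz : ‖c - z‖ ≤ S - d := by
    refine le_of_forall_pos_lt_add fun e he => ?_
    obtain ⟨c', h1, h2⟩ := hex (min (e / 2) (d / 2)) (by positivity)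
      ((min_le_right _ _).trans_lt (by linarith))
    have h3 : Metric.infDist z Y ≤ dist z c' := Metric.infDist_le_dist_of_mem h2
    rw [hc, dist_comm, dist_eq_norm, dist_comm, dist_eq_norm] at h3
    have := min_le_left (e / 2) (d / 2)
    linarith
  have hout : ∀ y ∈ X, S ≤ ‖c - y‖ := fun y hy => by
    rw [← dist_eq_norm]; exact hcY.trans (Metric.infDist_le_dist_of_mem hy)
  have hS0 : 0 < S := by linarith
  -- Equality case of the triangle inequality for `‖c - p‖ ≥ S`, `‖c - z‖ ≤ S - d`, `‖z - p‖ = d`.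
  have hcol : d • (c - z) = (S - d) • (z - p) := by
    rw [← sub_eq_zero, ← norm_eq_zero]
    refine pow_eq_zero_iff two_ne_zero |>.1 (le_antisymm ?_ (sq_nonneg _))
    have h1 : S ^ 2 ≤ ‖(c - z) + (z - p)‖ ^ 2 := by
      rw [sub_add_sub_cancel]; gcongr; exact hout p hp
    rw [norm_add_sq_real, hzp] at h1
    have h2 : ‖c - z‖ ^ 2 ≤ (S - d) ^ 2 := by gcongr
    rw [norm_sub_sq_real, norm_smul, norm_smul, real_inner_smul_left, real_inner_smul_right, hzp,
      Real.norm_of_nonneg hd0.le, Real.norm_of_nonneg (by linarith : 0 ≤ S - d)]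
    nlinarith [mul_le_mul_of_nonneg_left h1 (mul_nonneg hd0.le (sub_nonneg.2 hzS)),
      mul_le_mul_of_nonneg_left h2 (mul_nonneg hd0.le (sub_nonneg.2 hzS)),
      mul_le_mul_of_nonneg_left h2 (mul_nonneg hd0.le hd0.le)]
  have hcp : d • (c - p) = S • (z - p) := by
    rw [← sub_add_sub_cancel c z p, smul_add, hcol, ← add_smul, sub_add_cancel]
  have hcpn : ‖c - p‖ = S := by
    have := congrArg norm hcp
    rw [norm_smul, norm_smul, hzp, Real.norm_of_nonneg hd0.le, Real.norm_of_nonneg hS0.le,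
      mul_comm S] at this
    exact mul_left_cancel₀ hd0.ne' this
  have h1 : S ^ 2 ≤ ‖(c - p) - (x - p)‖ ^ 2 := by
    rw [sub_sub_sub_cancel_right]; gcongr; exact hout x hx
  rw [norm_sub_sq_real, hcpn, real_inner_comm] at h1
  have h2 : S * ⟪x - p, z - p⟫ = d * ⟪x - p, c - p⟫ := by
    rw [← real_inner_smul_right, ← hcp, real_inner_smul_right]
  nlinarith

/-- The nearest points `p`, `p'` of `z`, `z'` are at most twice as far apart as `z` and `z'`, when
each lies outside the ball of radius `S` tangent at the other. -/
theorem norm_proj_sub_le {S d d' : ℝ} {z z' p p' : E} (hS : 0 < S) (hd : 2 * d ≤ S)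
    (hd' : 2 * d' ≤ S) (h : 2 * S * ⟪p' - p, z - p⟫ ≤ d * ‖p' - p‖ ^ 2)
    (h' : 2 * S * ⟪p - p', z' - p'⟫ ≤ d' * ‖p - p'‖ ^ 2) : ‖p - p'‖ ≤ 2 * ‖z - z'‖ := by
  have e : ⟪p' - p, z - p⟫ + ⟪p - p', z' - p'⟫ = ‖p - p'‖ ^ 2 - ⟪p - p', z - z'⟫ := by
    rw [← real_inner_self_eq_norm_sq]
    simp only [inner_sub_left, inner_sub_right]
    ring
  have h1 := real_inner_le_norm (p - p') (z - z')
  rw [norm_sub_rev p' p] at h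
  -- In the sum of `h` and `h'`, the bound `d + d' ≤ S` lets half of `‖p - p'‖ ^ 2` absorb the right
  -- side.
  have h2 : S * ‖p - p'‖ ^ 2 ≤ S * (2 * (‖p - p'‖ * ‖z - z'‖)) := by
    nlinarith [sq_nonneg ‖p - p'‖]
  have h3 := le_of_mul_le_mul_left h2 hS
  rcases (norm_nonneg (p - p')).eq_or_lt with h0 | h0
  · rw [← h0]; positivity
  · refine le_of_mul_le_mul_left ?_ h0
    linarith

/-- The nearest point of a point of a segment with ends in `X ∩ ball 0 ρ` stays in `ball 0 ρ`, when
`X` lies outside the tangent balls of radius `S ≥ 2 ρ`. -/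
theorem norm_proj_lt {S ρ t : ℝ} {x y z p : E} (hρS : 2 * ρ ≤ S) (hx : ‖x‖ < ρ)
    (hy : ‖y‖ < ρ) (ht0 : 0 ≤ t) (ht1 : t ≤ 1) (hz : z = x + t • (y - x))
    (hd : ‖z - p‖ < ρ)
    (h : 2 * S * ⟪x - p, z - p⟫ ≤ ‖z - p‖ * ‖x - p‖ ^ 2)
    (h' : 2 * S * ⟪y - p, z - p⟫ ≤ ‖z - p‖ * ‖y - p‖ ^ 2) : ‖p‖ < ρ := by
  set d := ‖z - p‖ with hdef
  have hd0 : 0 ≤ d := norm_nonneg _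
  have hρ : 0 < ρ := (norm_nonneg x).trans_lt hx
  set a := t * (1 - t) * ‖y - x‖ ^ 2 with ha
  -- Stewart's identity; `a` measures how far the chord sinks into the ball.
  have hconv : ∀ v : E, (1 - t) * ‖x - v‖ ^ 2 + t * ‖y - v‖ ^ 2 = ‖z - v‖ ^ 2 + a := fun v => by
    have e1 : z - v = (x - v) + t • (y - x) := by rw [hz]; abel
    have e2 : y - v = (x - v) + (y - x) := by abel
    rw [e1, e2, ha, norm_add_sq_real, norm_add_sq_real, real_inner_smul_right, norm_smul,
      Real.norm_of_nonneg ht0]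
    ring
  have hin : (1 - t) * ⟪x - p, z - p⟫ + t * ⟪y - p, z - p⟫ = d ^ 2 := by
    rw [← real_inner_smul_left, ← real_inner_smul_left, ← inner_add_left, hdef,
      ← real_inner_self_eq_norm_sq]
    congr 1
    rw [hz]; module
  have h1 : 2 * S * d ^ 2 ≤ d * (d ^ 2 + a) := by
    have h2 := hconv p
    rw [← hdef] at h2
    rw [← h2, ← hin]
    nlinarith [mul_le_mul_of_nonneg_left h (sub_nonneg.2 ht1), mul_le_mul_of_nonneg_left h' ht0]
  have ha0 : 0 ≤ a := by have := sub_nonneg.2 ht1; positivity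
  have h2 : 2 * ρ * d ≤ a := by
    rcases hd0.eq_or_lt with h0 | h0
    · rw [← h0]; simpa using ha0
    · have : 2 * S * d ≤ d ^ 2 + a := le_of_mul_le_mul_left (by linarith) h0
      nlinarith
  have h3 : ‖z‖ ^ 2 < ρ ^ 2 - a := by
    have h4 := hconv 0
    simp only [sub_zero] at h4
    have hx2 : ‖x‖ ^ 2 < ρ ^ 2 := by gcongr
    have hy2 : ‖y‖ ^ 2 < ρ ^ 2 := by gcongr
    rcases ht0.eq_or_lt with h0 | h0
    · subst h0; linarith
    · nlinarith [mul_lt_mul_of_pos_left hy2 h0,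
        mul_le_mul_of_nonneg_left hx2.le (sub_nonneg.2 ht1)]
  -- `ρ² - a ≤ ρ² - 2ρd ≤ (ρ - d)²`: the sinking pays for the displacement `d`.
  have h4 : ‖z‖ < ρ - d := by
    refine abs_lt_of_sq_lt_sq' ?_ (by linarith) |>.2
    nlinarith
  calc ‖p‖ = ‖z - (z - p)‖ := by rw [sub_sub_cancel]
    _ ≤ ‖z‖ + d := norm_sub_le _ _
    _ < ρ := by linarith

end Reach

/-! ### Unique nearest points imply normal embedding -/

/-- If `0 ∈ X` and `X` is closed and has unique nearest points near `0`, then it is normally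
embedded at `0`. -/
theorem isNormallyEmbeddedAt_of_unique {n : ℕ} {X : Set (Euc n)} (hX : IsClosed X)
    (h0 : (0 : Euc n) ∈ X) {r : ℝ} (hr : 0 < r)
    (huniq : ∀ c : Euc n, ‖c‖ < r → c ∉ X →
      ∀ p ∈ X, ∀ q ∈ X, ‖c - p‖ = Metric.infDist c X → ‖c - q‖ = Metric.infDist c X → p = q) :
    IsNormallyEmbeddedAt X 0 := by
  choose π hπX hπ using fun z : Euc n => hX.exists_infDist_eq_dist ⟨0, h0⟩ z
  simp only [dist_eq_norm] at hπ
  have hle : ∀ z : Euc n, Metric.infDist z X ≤ ‖z‖ := fun z => by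
    rw [← dist_zero_right]; exact Metric.infDist_le_dist_of_mem h0
  -- As `0 ∈ X`, `‖z‖ < r / 6` bounds the distance to `X` by half of `S = r / 3`, and the ball of
  -- radius `r / 2` around `z` stays in the uniqueness region.
  have hkey : ∀ z : Euc n, ‖z‖ < r / 6 → ∀ x ∈ X,
      2 * (r / 3) * inner ℝ (x - π z) (z - π z) ≤ Metric.infDist z X * ‖x - π z‖ ^ 2 := by
    intro z hz x hx
    refine inner_sub_le_of_unique (T := r / 2) hX (hπX z) (hπ z).symm hx
      (by have := hle z; linarith) (by linarith) fun c hc => huniq c ?_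
    have := norm_le_norm_add_norm_sub' c z
    linarith
  have hfix : ∀ x ∈ X, π x = x := fun x hx => by
    have := hπ x
    rw [Metric.infDist_zero_of_mem hx] at this
    exact (sub_eq_zero.1 (norm_eq_zero.1 this.symm)).symm
  refine ⟨Metric.ball 0 (r / 6), Metric.isOpen_ball, Metric.mem_ball_self (by positivity), 2,
    two_pos, ?_⟩
  rintro x ⟨hxX, hx⟩ y ⟨hyX, hy⟩
  rw [mem_ball_zero_iff] at hx hy
  set ℓ : ℝ → Euc n := fun t => x + t • (y - x) with hℓ
  have hℓn : ∀ t ∈ Icc (0 : ℝ) 1, ‖ℓ t‖ < r / 6 := fun t ht => by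
    have := (convex_ball (0 : Euc n) (r / 6)).add_smul_sub_mem (mem_ball_zero_iff.2 hx)
      (mem_ball_zero_iff.2 hy) ht
    exact mem_ball_zero_iff.1 this
  have hLip : LipschitzOnWith (2 * nndist x y) (fun t => π (ℓ t)) (Icc 0 1) := by
    refine LipschitzOnWith.of_dist_le_mul fun s hs t ht => ?_
    have hs' := hℓn s hs
    have ht' := hℓn t ht
    have h1 := norm_proj_sub_le (S := r / 3) (by positivity)
      (by have := hle (ℓ s); linarith) (by have := hle (ℓ t); linarith)
      (hkey _ hs' _ (hπX (ℓ t))) (hkey _ ht' _ (hπX (ℓ s)))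
    have h2 : ‖ℓ s - ℓ t‖ = dist x y * dist s t := by
      rw [show ℓ s - ℓ t = (s - t) • (y - x) by simp only [hℓ]; module, norm_smul, dist_comm x y,
        dist_eq_norm, dist_eq_norm, mul_comm]
    rw [dist_eq_norm]
    refine h1.trans_eq ?_
    rw [h2]
    simp [mul_assoc]
  have hlen : eVariationOn (fun t => π (ℓ t)) (Icc 0 1) ≤ 2 * edist x y := by
    have h1 := hLip.comp_eVariationOn_le (mapsTo_id (Icc (0 : ℝ) 1))
    have h2 := (monotoneOn_id (s := Icc (0 : ℝ) 1)).eVariationOn_eq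
      (left_mem_Icc.2 zero_le_one) (right_mem_Icc.2 zero_le_one)
    rw [inter_self] at h2
    calc _ ≤ _ := h1
      _ ≤ ((2 * nndist x y : ℝ≥0) : ℝ≥0∞) * 1 := by
        gcongr
        exact h2.le.trans (by simp)
      _ = _ := by rw [mul_one, ENNReal.coe_mul, edist_nndist]; rfl
  have hmem : (fun t => π (ℓ t)) ∈ rectifiablePaths (X ∩ Metric.ball 0 (r / 6)) x y := by
    refine ⟨hLip.continuousOn, fun t ht => ⟨hπX _, ?_⟩, ?_, ?_, ?_⟩
    · have hn := hℓn t ht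
      rw [mem_ball_zero_iff]
      refine norm_proj_lt (S := r / 3) (z := ℓ t) (by linarith) hx hy ht.1 ht.2 rfl ?_ ?_ ?_
      · rw [← hπ]; exact (hle _).trans_lt hn
      · rw [← hπ]; exact hkey _ hn x hxX
      · rw [← hπ]; exact hkey _ hn y hyX
    · simp [hℓ, hfix x hxX]
    · simp [hℓ, hfix y hyX]
    · exact ne_top_of_le_ne_top (ENNReal.mul_ne_top (by simp) (edist_ne_top x y)) hlen
  exact (iInf₂_le _ hmem).trans hlen

/-- A closed set has empty germ, hence dimension `⊥`, at each point outside it. -/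
theorem dimAt_eq_bot_of_notMem {n : ℕ} {X : Set (Euc n)} {a : Euc n} (hX : IsClosed X)
    (ha : a ∉ X) : dimAt X a = ⊥ := by
  refine le_bot_iff.1 ((iInf₂_le Xᶜ ⟨hX.isOpen_compl, ha⟩).trans ?_)
  rw [inter_compl_self]
  refine iSup₂_le ?_
  rintro k ⟨Γ, hΓ, ⟨x, hx⟩, -⟩
  exact (hΓ hx).elim

/-- Nearest points are unique at the points outside `X` that are not in the medial axis. -/
theorem eq_of_notMem_medialAxis {n : ℕ} {X : Set (Euc n)} {c p q : Euc n}
    (hc : c ∉ medialAxis X) (hcX : c ∉ X) (hp : p ∈ X) (hq : q ∈ X)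
    (hcp : ‖c - p‖ = Metric.infDist c X) (hcq : ‖c - q‖ = Metric.infDist c X) : p = q := by
  by_contra hne
  refine hc ⟨hcX, Set.one_lt_encard_iff.2 ⟨p, q, ⟨hp, ?_⟩, ⟨hq, ?_⟩, hne⟩⟩
  · rw [norm_sub_rev, hcp]
  · rw [norm_sub_rev, hcq]

end PlaneGerm

theorem mainTheorem4 (X : Set (PlaneGerm.Euc 2))
    (hsemialg : PlaneGerm.IsSemialgebraic X) (hclosed : IsClosed X)
    (hdim : PlaneGerm.dimAt X 0 = 1)
    (hnot : ¬ PlaneGerm.IsNormallyEmbeddedAt X 0) :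
    (0 : PlaneGerm.Euc 2) ∈ closure (PlaneGerm.medialAxis X) ∩ X := by
  -- Dimension `1` excludes the empty germ.
  have h0 : (0 : PlaneGerm.Euc 2) ∈ X := by
    by_contra h
    rw [PlaneGerm.dimAt_eq_bot_of_notMem hclosed h] at hdim
    exact absurd hdim WithBot.bot_ne_one
  refine ⟨?_, h0⟩
  by_contra hcl
  obtain ⟨r, hr, hball⟩ := Metric.isOpen_iff.1 isClosed_closure.isOpen_compl _ hcl
  refine hnot (PlaneGerm.isNormallyEmbeddedAt_of_unique hclosed h0 hr
    fun c hc hcX p hp q hq hcp hcq => PlaneGerm.eq_of_notMem_medialAxis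
      (fun hm => hball (mem_ball_zero_iff.2 hc) (subset_closure hm)) hcX hp hq hcp hcq)
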